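/- Let $g\in\mathbb{R}$ with $0<g^2\le 1$ and let $P\ge 0$. Consider the symmetric real two-user Gaussian interference channel $$Y_1=X_1+gX_2+Z_1,\qquad Y_2=X_2+gX_1+Z_2,$$ where the noises $Z_1,Z_2\sim\mathcal{N}(0,1)$ are i.i.d. over time and independent of the inputs. A $(2^{nR_1},2^{nR_2})$ code of block length $n$ consists of independent messages $M_i$, uniform on a set of $\lceil 2^{nR_i}\rceil$ elements, encoders mapping each message of user $i$ to a codeword $X_i^n\in\mathbb{R}^n$ with $\|X_i^n\|^2\le nP$, and (measurable) decoders estimating $M_i$ from $Y_i^n$, $i=1,2$. A rate pair $(R_1,R_2)$ with $R_1,R_2\ge 0$ is achievable if there is a sequence of such codes, $n=1,2,\dots$, for which both average error probabilities $\Pr(\mathrm{dec}_i(Y_i^n)\ne M_i)$, $i=1,2$, tend to $0$ as $n\to\infty$; the capacity region is the closure of the set of achievable rate pairs. Then every rate pair $(R_1,R_2)$ in the capacity region satisfies $$R_1+R_2\;\le\;\overline{R}:=R^*_{\mathrm{sym}}+\gamma(g),\qquad R^*_{\mathrm{sym}}=\tfrac12\log_2\!\big(|g|P+|g|^{-1}(P+1)\big),$$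 where $$\gamma(g)=\begin{cases}\tfrac12\log_2\dfrac{4g^2+1}{4|g|}, & 0<g^2\le 0.405,\\[2mm] \tfrac12\log_2\dfrac{2g^2}{\sqrt{4g^2-1}}, & 0.405<g^2\le 1.\end{cases}$$ -/

import Mathlib

open Filter Topology MeasureTheory ProbabilityTheory

noncomputable section

namespace GIC

/-- A code of block length `n` with message sets of sizes `M₁`, `M₂` for the two-user real Gaussian
interference channel, with (per-codeword) average power constraint `P` at both transmitters:
`‖xᵢⁿ(m)‖² ≤ n P`. Encoders are deterministic and the decoders measurable. -/
structure Code (n M₁ M₂ : ℕ) (P : ℝ) where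
  enc₁ : Fin M₁ → (Fin n → ℝ)
  enc₂ : Fin M₂ → (Fin n → ℝ)
  dec₁ : (Fin n → ℝ) → Fin M₁
  dec₂ : (Fin n → ℝ) → Fin M₂
  power₁ : ∀ m, ∑ j, enc₁ m j ^ 2 ≤ n * P
  power₂ : ∀ m, ∑ j, enc₂ m j ^ 2 ≤ n * P
  measurable_dec₁ : Measurable dec₁
  measurable_dec₂ : Measurable dec₂

/-- The law of `n` i.i.d. `N(0,1)` noise samples. -/
def noise (n : ℕ) : Measure (Fin n → ℝ) := Measure.pi fun _ => gaussianReal 0 1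

/-- Average probability of decoding error of user 1 over the symmetric channel
`Y₁ = X₁ + g X₂ + Z₁`, the messages being independent and uniform. -/
def errorProb₁ (g : ℝ) {n M₁ M₂ : ℕ} {P : ℝ} (c : Code n M₁ M₂ P) : ℝ :=
  (∑ m₁ : Fin M₁, ∑ m₂ : Fin M₂,
    (noise n).real {z | c.dec₁ (c.enc₁ m₁ + g • c.enc₂ m₂ + z) ≠ m₁}) / ((M₁ : ℝ) * M₂)

/-- Average probability of decoding error of user 2 over the symmetric channel
`Y₂ = X₂ + g X₁ + Z₂`, the messages being independent and uniform. -/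
def errorProb₂ (g : ℝ) {n M₁ M₂ : ℕ} {P : ℝ} (c : Code n M₁ M₂ P) : ℝ :=
  (∑ m₁ : Fin M₁, ∑ m₂ : Fin M₂,
    (noise n).real {z | c.dec₂ (c.enc₂ m₂ + g • c.enc₁ m₁ + z) ≠ m₂}) / ((M₁ : ℝ) * M₂)

/-- The number of messages `⌈2^{nR}⌉` of a code of block length `n` and rate `R`
(bits per channel use). -/
def numMessages (n : ℕ) (R : ℝ) : ℕ := ⌈(2 : ℝ) ^ (n * R)⌉₊

/-- The rate pair `R = (R₁, R₂)` is achievable: there is a sequence of `(2^{nR₁}, 2^{nR₂})` codes,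
one for every block length `n`, whose two average error probabilities tend to zero. -/
def Achievable (g P : ℝ) (R : ℝ × ℝ) : Prop :=
  0 ≤ R.1 ∧ 0 ≤ R.2 ∧
    ∃ c : ∀ n : ℕ, Code n (numMessages n R.1) (numMessages n R.2) P,
      Tendsto (fun n => errorProb₁ g (c n)) atTop (𝓝 0) ∧
      Tendsto (fun n => errorProb₂ g (c n)) atTop (𝓝 0)

/-- The capacity region of the symmetric real two-user Gaussian interference channel with
cross-channel coefficient `g` and power `P`. -/
def capacityRegion (g P : ℝ) : Set (ℝ × ℝ) := closure {R | Achievable g P R}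

/-- `R*_sym = ½ log₂ (|g| P + |g|⁻¹ (P + 1))`. -/
def Rsym (g P : ℝ) : ℝ := 1 / 2 * Real.logb 2 (|g| * P + |g|⁻¹ * (P + 1))

/-- The excess `γ(g)`, for `0 < g² ≤ 1`. -/
def gamma (g : ℝ) : ℝ :=
  if g ^ 2 ≤ 0.405 then 1 / 2 * Real.logb 2 ((4 * g ^ 2 + 1) / (4 * |g|))
  else 1 / 2 * Real.logb 2 (2 * g ^ 2 / √(4 * g ^ 2 - 1))

/-- The upper bound `R̄ = R*_sym + γ(g)`. -/
def Rbar (g P : ℝ) : ℝ := Rsym g P + gamma g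

end GIC

end

noncomputable section

namespace GIC

open scoped ENNReal NNReal

/-! ### Gaussian densities on ℝⁿ -/

section

/-! Let X₁, X₂ be uniform on the two codebooks and h denote differential entropy. Up to Fano terms,
three bounds hold for nR₁, and symmetrically for nR₂, at every block length.

(A) `fanoRate_le_of_power`: treating the interference as noise gives h(Y₁) − h(gX₂ + Z), and h(Y₁)
is at most the Gaussian value allowed by the power constraints. (B)
`fanoRate_le_of_noisy_interference`: for s²/4 + r² = 1 the output can be split as the sum of X₁ +
sZ' and gX₂ − (s/2)Z' + rZ''. A receiver seeing both summands gets at most h(X₁ + sZ) + h(gX₂ + Z) −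
h(sZ) − h(gX₂ + rZ). (C) `fanoRate_le_of_interference`: a receiver that knows gX₂ and has noise
level c ≤ 1 gets at most h(X₁ + cZ) − h(cZ).

The free noise levels are chosen so that all entropies depending on the codebooks cancel, using the
scaling rule `ent_smul`. With r = |g|s, the sum of A and B over both users leaves only explicit
Gaussian terms. With s = 1/|g| and r = |g|c, the combination 2A + B + C does the same. These are the
two branches of `gamma`.

All three bounds are instances of `converse_bound`, which merges Fano's inequality, data processing
and the comparison with an auxiliary output law into one application of log t ≤ t − 1. It remains to
divide by n, let the errors vanish, and pass to the closure. -/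

instance (n : ℕ) : IsProbabilityMeasure (noise n) := by unfold noise; infer_instance

/-- Product measures are determined by boxes; the indicator of a box factors over coordinates, so
the integral of the product density splits into one-dimensional ones. -/
lemma _root_.MeasureTheory.Measure.pi_withDensity_ofReal {ι : Type*} [Fintype ι]
    (f : ι → ℝ → ℝ) (hf : ∀ i x, 0 ≤ f i x) (hfi : ∀ i, Integrable (f i)) :
    Measure.pi (fun i => (volume : Measure ℝ).withDensity (fun x => ENNReal.ofReal (f i x)))
      = (volume : Measure (ι → ℝ)).withDensity
          (fun y => ENNReal.ofReal (∏ i, f i (y i))) := by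
  have hfin (i : ι) : IsFiniteMeasure
      ((volume : Measure ℝ).withDensity (fun x => ENNReal.ofReal (f i x))) :=
    isFiniteMeasure_withDensity_ofReal (hfi i).2
  refine Measure.pi_eq fun s hs => ?_
  have hpi : MeasurableSet (Set.univ.pi s) := MeasurableSet.univ_pi hs
  have key : ∀ y : ι → ℝ, (Set.univ.pi s).indicator (fun y => ∏ i, f i (y i)) y
      = ∏ i, (s i).indicator (f i) (y i) := by
    intro y
    by_cases hy : y ∈ Set.univ.pi s
    · rw [Set.indicator_of_mem hy]
      exact Finset.prod_congr rfl fun i _ => by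
        rw [Set.indicator_of_mem (hy i (Set.mem_univ i))]
    · rw [Set.indicator_of_notMem hy]
      simp only [Set.mem_pi, Set.mem_univ, true_implies, not_forall] at hy
      obtain ⟨i, hi⟩ := hy
      exact (Finset.prod_eq_zero (Finset.mem_univ i) (Set.indicator_of_notMem hi _)).symm
  rw [withDensity_apply _ hpi, ← lintegral_indicator hpi]
  have h1 : ∀ y : ι → ℝ, (Set.univ.pi s).indicator
      (fun y => ENNReal.ofReal (∏ i, f i (y i))) y
      = ENNReal.ofReal (∏ i, (s i).indicator (f i) (y i)) := by
    intro y
    rw [← key]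
    by_cases hy : y ∈ Set.univ.pi s <;> simp [Set.indicator, hy]
  have hi (i : ι) : Integrable ((s i).indicator (f i)) := (hfi i).indicator (hs i)
  have h0 (i : ι) (x : ℝ) : 0 ≤ (s i).indicator (f i) x :=
    Set.indicator_nonneg (fun x _ => hf i x) x
  simp_rw [h1]
  have hprod : Integrable (fun y : ι → ℝ => ∏ i, (s i).indicator (f i) (y i)) volume :=
    Integrable.fintype_prod hi
  rw [← ofReal_integral_eq_lintegral_ofReal hprod
    (Eventually.of_forall fun y => Finset.prod_nonneg fun i _ => h0 i _),
    volume_pi, integral_fintype_prod_eq_prod,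
    ENNReal.ofReal_prod_of_nonneg fun i _ => integral_nonneg (h0 i)]
  refine Finset.prod_congr rfl fun i _ => ?_
  rw [withDensity_apply _ (hs i), integral_indicator (hs i),
    ofReal_integral_eq_lintegral_ofReal (hfi i).integrableOn (Eventually.of_forall (hf i))]

/-- The density of `n` independent Gaussians with means `x j` and common standard deviation `s`. -/
def gaussDensity {n : ℕ} (x : Fin n → ℝ) (s : ℝ) (y : Fin n → ℝ) : ℝ :=
  ∏ j, gaussianPDFReal (x j) (NNReal.mk (s ^ 2) (sq_nonneg s)) (y j)

variable {n : ℕ}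

lemma gaussDensity_pos (x y : Fin n → ℝ) {s : ℝ} (hs : 0 < s) : 0 < gaussDensity x s y :=
  Finset.prod_pos fun j _ => gaussianPDFReal_pos _ _ _
    (by rw [ne_eq, ← NNReal.coe_eq_zero]; exact (pow_pos hs 2).ne')

lemma measurable_gaussDensity (x : Fin n → ℝ) (s : ℝ) : Measurable (gaussDensity x s) := by
  unfold gaussDensity
  exact Finset.measurable_prod _ fun j _ =>
    (measurable_gaussianPDFReal _ _).comp (measurable_pi_apply j)

lemma map_noise (x : Fin n → ℝ) {s : ℝ} (hs : 0 < s) :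
    (noise n).map (fun z => x + s • z)
      = volume.withDensity (fun y => ENNReal.ofReal (gaussDensity x s y)) := by
  have hv : NNReal.mk (s ^ 2) (sq_nonneg s) ≠ 0 := by
    rw [ne_eq, ← NNReal.coe_eq_zero]; exact (pow_pos hs 2).ne'
  have h1 (j : Fin n) : (gaussianReal 0 1).map (fun t => x j + s * t)
      = (volume : Measure ℝ).withDensity
        (fun t => ENNReal.ofReal (gaussianPDFReal (x j) (NNReal.mk (s ^ 2) (sq_nonneg s)) t)) := by
    have : (fun t => x j + s * t) = (fun t => x j + t) ∘ (fun t => s * t) := rfl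
    rw [this, ← Measure.map_map (by fun_prop) (by fun_prop), gaussianReal_map_const_mul,
      gaussianReal_map_const_add, mul_one, mul_zero, zero_add, gaussianReal_of_var_ne_zero _ hv]
    rfl
  have h2 : (fun z : Fin n → ℝ => x + s • z) = fun z j => x j + s * z j := rfl
  have (j : Fin n) : SigmaFinite ((gaussianReal 0 1).map (fun t => x j + s * t)) := by
    have := Measure.isProbabilityMeasure_map (μ := gaussianReal 0 1)
      (f := fun t => x j + s * t) (by fun_prop)
    infer_instance
  rw [h2, noise, Measure.pi_map_pi (f := fun j t => x j + s * t)
    (fun j => by fun_prop)]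
  simp_rw [h1]
  exact Measure.pi_withDensity_ofReal _ (fun j t => gaussianPDFReal_nonneg _ _ _)
    fun j => integrable_gaussianPDFReal _ _

lemma lintegral_noise (x : Fin n → ℝ) {s : ℝ} (hs : 0 < s) {f : (Fin n → ℝ) → ℝ≥0∞}
    (hf : Measurable f) :
    ∫⁻ z, f (x + s • z) ∂noise n = ∫⁻ y, f y * ENNReal.ofReal (gaussDensity x s y) := by
  rw [← lintegral_map hf (by fun_prop : Measurable fun z : Fin n → ℝ => x + s • z),
    map_noise x hs, lintegral_withDensity_eq_lintegral_mul _
    (measurable_gaussDensity x s).ennreal_ofReal hf]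
  simp only [Pi.mul_apply, mul_comm]

lemma lintegral_gaussDensity (x : Fin n → ℝ) {s : ℝ} (hs : 0 < s) :
    ∫⁻ y, ENNReal.ofReal (gaussDensity x s y) = 1 := by
  simpa using (lintegral_noise x hs (f := fun _ => 1) measurable_const).symm

lemma gaussDensity_add (x u y : Fin n → ℝ) (s : ℝ) :
    gaussDensity (x + u) s y = gaussDensity u s (y - x) := by
  unfold gaussDensity
  refine Finset.prod_congr rfl fun j _ => ?_
  simp only [gaussianPDFReal_def, Pi.add_apply, Pi.sub_apply]
  congr 3
  ring_nf

lemma gaussDensity_smul (x y : Fin n → ℝ) {g s : ℝ} (hg : g ≠ 0) (hs : 0 < s) :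
    gaussDensity (g • x) (|g| * s) (g • y) = (|g| ^ n)⁻¹ * gaussDensity x s y := by
  unfold gaussDensity
  have : ∀ j, gaussianPDFReal ((g • x) j) (NNReal.mk ((|g| * s) ^ 2) (sq_nonneg _)) ((g • y) j)
      = |g|⁻¹ * gaussianPDFReal (x j) (NNReal.mk (s ^ 2) (sq_nonneg s)) (y j) := by
    intro j
    have hg' := abs_pos.2 hg
    simp only [gaussianPDFReal_def, Pi.smul_apply, smul_eq_mul, NNReal.coe_mk]
    have e1 : √(2 * Real.pi * (|g| * s) ^ 2) = |g| * √(2 * Real.pi * s ^ 2) := by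
      rw [show 2 * Real.pi * (|g| * s) ^ 2 = |g| ^ 2 * (2 * Real.pi * s ^ 2) by ring,
        Real.sqrt_mul (by positivity), Real.sqrt_sq hg'.le]
    have e2 : -(g * y j - g * x j) ^ 2 / (2 * (|g| * s) ^ 2)
        = -(y j - x j) ^ 2 / (2 * s ^ 2) := by
      rw [mul_pow, sq_abs]; field_simp
    rw [e1, e2, mul_inv, mul_assoc]
  simp_rw [this]
  rw [Finset.prod_mul_distrib]
  simp

lemma log_gaussDensity (x y : Fin n → ℝ) {s : ℝ} (hs : 0 < s) :
    Real.log (gaussDensity x s y)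
      = -(n * (Real.log s + Real.log (2 * Real.pi) / 2)) - (∑ j, (y j - x j) ^ 2) / (2 * s ^ 2) := by
  unfold gaussDensity
  have hv : NNReal.mk (s ^ 2) (sq_nonneg s) ≠ 0 := by
    rw [ne_eq, ← NNReal.coe_eq_zero]; exact (pow_pos hs 2).ne'
  rw [Real.log_prod fun j _ => (gaussianPDFReal_pos _ _ _ hv).ne']
  have : ∀ j, Real.log (gaussianPDFReal (x j) (NNReal.mk (s ^ 2) (sq_nonneg s)) (y j))
      = -(Real.log s + Real.log (2 * Real.pi) / 2) - (y j - x j) ^ 2 / (2 * s ^ 2) := by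
    intro j
    have hpi := Real.pi_pos
    rw [gaussianPDFReal_def]
    simp only [NNReal.coe_mk]
    rw [Real.log_mul (by positivity) (Real.exp_pos _).ne', Real.log_exp, Real.log_inv,
      Real.log_sqrt (by positivity), Real.log_mul (by positivity) (by positivity), Real.log_pow]
    push_cast
    ring
  simp_rw [this]
  rw [Finset.sum_sub_distrib, Finset.sum_div]
  simp [Finset.sum_const]
  ring

/-- The sum of independent centred Gaussian vectors whose variances add up to `1`. -/
lemma measurePreserving_noise {c d : ℝ} (h : c ^ 2 + d ^ 2 = 1) :
    MeasurePreserving (fun z : (Fin n → ℝ) × (Fin n → ℝ) => c • z.1 + d • z.2)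
      ((noise n).prod (noise n)) (noise n) := by
  have h1 : MeasurePreserving (fun p : ℝ × ℝ => c * p.1 + d * p.2)
      ((gaussianReal 0 1).prod (gaussianReal 0 1)) (gaussianReal 0 1) := by
    refine ⟨by fun_prop, ?_⟩
    have e : (fun p : ℝ × ℝ => c * p.1 + d * p.2)
        = (fun p : ℝ × ℝ => p.1 + p.2) ∘ (Prod.map (c * ·) (d * ·)) := rfl
    rw [e, ← Measure.map_map (by fun_prop) (by fun_prop),
      ← Measure.map_prod_map _ _ (by fun_prop) (by fun_prop), gaussianReal_map_const_mul,
      gaussianReal_map_const_mul]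
    have := gaussianReal_conv_gaussianReal (m₁ := c * 0) (m₂ := d * 0)
      (v₁ := .mk (c ^ 2) (sq_nonneg _) * 1) (v₂ := .mk (d ^ 2) (sq_nonneg _) * 1)
    rw [Measure.conv] at this
    rw [this]
    congr 1
    · simp
    · ext; simpa using h
  have h2 := measurePreserving_pi (fun _ : Fin n => (gaussianReal 0 1).prod (gaussianReal 0 1))
    (fun _ => gaussianReal 0 1) (fun _ => h1)
  have h3 := (measurePreserving_arrowProdEquivProdArrow ℝ ℝ (Fin n)
    (fun _ => gaussianReal 0 1) (fun _ => gaussianReal 0 1)).symm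
  exact h2.comp h3

end

/-! ### A one-shot converse -/

section

/-- A converse bound: the normalized information density against any output density `q` dominates
the rate of a code. The output for message `m` and interferer state `k` is `T m k`, and `p m` is the
output density for message `m`, averaged over `k`. -/
lemma converse_bound {α Ω ι κ : Type*} [MeasurableSpace α] [MeasurableSpace Ω] [Fintype ι]
    [Fintype κ] [Nonempty ι] [Nonempty κ] [DecidableEq ι] (μ : Measure α) (ν : Measure Ω)
    [IsProbabilityMeasure ν] (T : ι → κ → Ω → α) (hT : ∀ m k, Measurable (T m k))
    (dec : α → ι) (hdec : ∀ m, MeasurableSet (dec ⁻¹' {m}))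
    (p : ι → α → ℝ) (q : α → ℝ) (hp : ∀ m y, 0 < p m y) (hq : ∀ y, 0 < q y)
    (hpm : ∀ m, Measurable (p m)) (hqm : Measurable q)
    (hlaw : ∀ m, ∀ f : α → ℝ≥0∞, Measurable f →
      ∑ k, ∫⁻ ω, f (T m k ω) ∂ν = Fintype.card κ * ∫⁻ y, f y * ENNReal.ofReal (p m y) ∂μ)
    (hq1 : ∫⁻ y, ENNReal.ofReal (q y) ∂μ ≤ 1)
    (hip : ∀ m k, Integrable (fun ω => Real.log (p m (T m k ω))) ν)
    (hiq : ∀ m k, Integrable (fun ω => Real.log (q (T m k ω))) ν) :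
    (1 - (∑ m, ∑ k, ν.real {ω | dec (T m k ω) ≠ m}) / (Fintype.card ι * Fintype.card κ))
        * Real.log (Fintype.card ι) - Real.log 2
      ≤ (∑ m, ∑ k, (∫ ω, Real.log (p m (T m k ω)) ∂ν - ∫ ω, Real.log (q (T m k ω)) ∂ν))
        / (Fintype.card ι * Fintype.card κ) := by
  set M : ℝ := (Fintype.card ι : ℝ) with hM
  set K : ℝ := (Fintype.card κ : ℝ) with hK
  have hM1 : 1 ≤ M := by rw [hM]; exact_mod_cast Fintype.card_pos
  have hK0 : 0 < K := by rw [hK]; exact_mod_cast Fintype.card_pos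
  have hM0 : 0 < M := by linarith
  -- A likelihood ratio rewarding correct decoding: `log θ` is `log M - log 2` on success and `-log
  -- 2` on error, which yields the Fano expression, while the total over messages, (2M − 1)/2, stays
  -- below M.
  let θ : ι → α → ℝ := fun m y => if dec y = m then M / 2 else 1 / 2
  have hθ : ∀ m y, 0 < θ m y := fun m y => by
    simp only [θ]; split_ifs <;> positivity
  have hθm : ∀ m, Measurable (θ m) := fun m =>
    Measurable.ite (hdec m) measurable_const measurable_const
  have hθs : ∀ y, ∑ m, θ m y ≤ M := fun y => by
    have : ∀ m, θ m y = 1 / 2 + if dec y = m then (M - 1) / 2 else 0 := fun m => by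
      simp only [θ]; split_ifs <;> ring
    simp_rw [this]
    rw [Finset.sum_add_distrib, Finset.sum_ite_eq]
    simp only [Finset.sum_const, Finset.card_univ, nsmul_eq_mul, Finset.mem_univ, if_true, ← hM]
    linarith
  -- Under the true law the factor `p` cancels, so the mean of `F` over messages and interferer
  -- states is at most 1; applying log t ≤ t − 1 to `F` then gives the claim.
  let F : ι → α → ℝ := fun m y => q y * θ m y / p m y
  have hF : ∀ m y, 0 < F m y := fun m y => div_pos (mul_pos (hq y) (hθ m y)) (hp m y)
  have hFm : ∀ m, Measurable (F m) := fun m => (hqm.mul (hθm m)).div (hpm m)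
  have hFl : ∀ m, ∑ k, ∫⁻ ω, ENNReal.ofReal (F m (T m k ω)) ∂ν
      = Fintype.card κ * ∫⁻ y, ENNReal.ofReal (q y) * ENNReal.ofReal (θ m y) ∂μ := fun m => by
    rw [hlaw m _ (hFm m).ennreal_ofReal]
    congr 1
    refine lintegral_congr fun y => ?_
    rw [← ENNReal.ofReal_mul (hF m y).le, ← ENNReal.ofReal_mul (hq y).le]
    simp only [F]
    rw [div_mul_cancel₀ _ (hp m y).ne']
  have hFs : ∑ m, ∑ k, ∫⁻ ω, ENNReal.ofReal (F m (T m k ω)) ∂ν ≤ ENNReal.ofReal (M * K) := by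
    simp_rw [hFl]
    have hsw : ∑ m, ∫⁻ y, ENNReal.ofReal (q y) * ENNReal.ofReal (θ m y) ∂μ
        = ∫⁻ y, ∑ m, ENNReal.ofReal (q y) * ENNReal.ofReal (θ m y) ∂μ :=
      (lintegral_finsetSum _ fun m _ => hqm.ennreal_ofReal.mul (hθm m).ennreal_ofReal).symm
    rw [← Finset.mul_sum, hsw]
    have h1 : ∀ y, ∑ m, ENNReal.ofReal (q y) * ENNReal.ofReal (θ m y)
        ≤ ENNReal.ofReal (q y) * ENNReal.ofReal M := fun y => by
      rw [← Finset.mul_sum, ← ENNReal.ofReal_sum_of_nonneg fun m _ => (hθ m y).le]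
      gcongr
      exact hθs y
    calc _ ≤ (Fintype.card κ : ℝ≥0∞) * ∫⁻ y, ENNReal.ofReal (q y) * ENNReal.ofReal M ∂μ := by
          gcongr with y; exact h1 y
      _ ≤ (Fintype.card κ : ℝ≥0∞) * (1 * ENNReal.ofReal M) := by
          rw [lintegral_mul_const _ hqm.ennreal_ofReal]; gcongr
      _ = ENNReal.ofReal (M * K) := by
          rw [one_mul, mul_comm M K, ENNReal.ofReal_mul hK0.le, hK, hM, ENNReal.ofReal_natCast,
            ENNReal.ofReal_natCast]
  have hFfin : ∀ m k, ∫⁻ ω, ENNReal.ofReal (F m (T m k ω)) ∂ν < ∞ := fun m k => by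
    refine lt_of_le_of_lt ?_ (lt_of_le_of_lt hFs ENNReal.ofReal_lt_top)
    exact le_trans (Finset.single_le_sum (f := fun k => ∫⁻ ω, ENNReal.ofReal (F m (T m k ω)) ∂ν)
      (fun _ _ => zero_le) (Finset.mem_univ k))
      (Finset.single_le_sum (f := fun m => ∑ k, ∫⁻ ω, ENNReal.ofReal (F m (T m k ω)) ∂ν)
      (fun _ _ => zero_le) (Finset.mem_univ m))
  have hFi : ∀ m k, Integrable (fun ω => F m (T m k ω)) ν := fun m k =>
    lintegral_ofReal_ne_top_iff_integrable ((hFm m).comp (hT m k)).aestronglyMeasurable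
      (Eventually.of_forall fun ω => (hF m _).le) |>.1 (hFfin m k).ne
  have hFr : ∑ m, ∑ k, ∫ ω, F m (T m k ω) ∂ν ≤ M * K := by
    have h0 : ∀ m k, 0 ≤ ∫ ω, F m (T m k ω) ∂ν := fun m k =>
      integral_nonneg fun ω => (hF m _).le
    rw [← ENNReal.ofReal_le_ofReal_iff (by positivity)]
    refine le_trans (le_of_eq ?_) hFs
    rw [ENNReal.ofReal_sum_of_nonneg fun m _ => Finset.sum_nonneg fun k _ => h0 m k]
    refine Finset.sum_congr rfl fun m _ => ?_
    rw [ENNReal.ofReal_sum_of_nonneg fun k _ => h0 m k]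
    refine Finset.sum_congr rfl fun k _ => ?_
    exact ofReal_integral_eq_lintegral_ofReal (hFi m k)
      (Eventually.of_forall fun ω => (hF m _).le)
  have hset : ∀ m k, MeasurableSet {ω | dec (T m k ω) ≠ m} := fun m k =>
    ((hT m k) (hdec m)).compl
  have hθe : ∀ m k ω, Real.log (θ m (T m k ω)) = Real.log M - Real.log 2
      - {ω | dec (T m k ω) ≠ m}.indicator (fun _ => Real.log M) ω := fun m k ω => by
    simp only [θ]
    by_cases h : dec (T m k ω) = m
    · simp [h, Real.log_div hM0.ne' two_ne_zero]
    · simp [h]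
  have hθi : ∀ m k, Integrable (fun ω => Real.log (θ m (T m k ω))) ν := fun m k => by
    simp_rw [hθe]
    exact (integrable_const _).sub ((integrable_const _).indicator (hset m k))
  have hθv : ∀ m k, ∫ ω, Real.log (θ m (T m k ω)) ∂ν
      = Real.log M - Real.log 2 - ν.real {ω | dec (T m k ω) ≠ m} * Real.log M := fun m k => by
    simp_rw [hθe]
    rw [integral_sub (integrable_const _) ((integrable_const _).indicator (hset m k)),
      integral_indicator_const _ (hset m k)]
    simp
  have hstep : ∀ m k, ∫ ω, Real.log (q (T m k ω)) ∂ν - ∫ ω, Real.log (p m (T m k ω)) ∂ν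
      + (Real.log M - Real.log 2 - ν.real {ω | dec (T m k ω) ≠ m} * Real.log M)
      ≤ ∫ ω, F m (T m k ω) ∂ν - 1 := fun m k => by
    rw [← hθv, ← integral_sub (hiq m k) (hip m k)]
    have hadd := integral_add ((hiq m k).sub (hip m k)) (hθi m k)
    simp only [Pi.sub_apply] at hadd
    rw [← hadd]
    have : ∫ ω, F m (T m k ω) ∂ν - 1 = ∫ ω, (F m (T m k ω) - 1) ∂ν := by
      rw [integral_sub (hFi m k) (integrable_const _)]; simp
    rw [this]
    refine integral_mono (((hiq m k).sub (hip m k)).add (hθi m k))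
      ((hFi m k).sub (integrable_const _)) fun ω => ?_
    have h := Real.log_le_sub_one_of_pos (hF m (T m k ω))
    simp only [F] at h
    rw [Real.log_div (mul_pos (hq _) (hθ m _)).ne' (hp m _).ne',
      Real.log_mul (hq _).ne' (hθ m _).ne'] at h
    simp only [F]
    linarith
  have hsum := Finset.sum_le_sum fun m (_ : m ∈ Finset.univ) =>
    Finset.sum_le_sum fun k (_ : k ∈ Finset.univ) => hstep m k
  simp only [Finset.sum_add_distrib, Finset.sum_sub_distrib, Finset.sum_const, Finset.card_univ,
    nsmul_eq_mul, ← Finset.sum_mul, ← hM, ← hK] at hsum ⊢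
  rw [le_div_iff₀ (by positivity), sub_mul, sub_mul, one_mul, sub_mul, div_mul_eq_mul_div,
    div_mul_cancel₀ _ (by positivity)]
  nlinarith [hsum, hFr]

end

/-! ### Gaussian mixtures and their entropies -/

section

variable {n : ℕ} {ι : Type*} [Fintype ι]

/-- The density of `X + s Z` for `X` uniform on the codebook `x` and `Z` standard Gaussian. -/
def mixDensity (x : ι → Fin n → ℝ) (s : ℝ) (y : Fin n → ℝ) : ℝ :=
  (∑ i, gaussDensity (x i) s y) / Fintype.card ι

/-- The differential entropy of `X + s Z` for `X` uniform on the codebook `x` and `Z` standard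
Gaussian. -/
def ent (x : ι → Fin n → ℝ) (s : ℝ) : ℝ :=
  -((∑ i, ∫ z, Real.log (mixDensity x s (x i + s • z)) ∂noise n) / Fintype.card ι)

lemma measurable_mixDensity (x : ι → Fin n → ℝ) (s : ℝ) : Measurable (mixDensity x s) := by
  unfold mixDensity
  exact (Finset.measurable_sum _ fun i _ => measurable_gaussDensity (x i) s).div_const _

lemma mixDensity_smul (x : ι → Fin n → ℝ) (y : Fin n → ℝ) {g s : ℝ} (hg : g ≠ 0) (hs : 0 < s) :
    mixDensity (fun i => g • x i) (|g| * s) (g • y) = (|g| ^ n)⁻¹ * mixDensity x s y := by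
  unfold mixDensity
  simp_rw [gaussDensity_smul _ _ hg hs, ← Finset.mul_sum, mul_div_assoc]

lemma memLp_noise_eval (j : Fin n) : MemLp (fun z : Fin n → ℝ => z j) 2 (noise n) :=
  (memLp_id_gaussianReal (μ := 0) (v := 1) 2).comp_measurePreserving
    (measurePreserving_eval (fun _ : Fin n => gaussianReal 0 1) j)

lemma integral_noise_eval (j : Fin n) : ∫ z, z j ∂noise n = 0 := by
  have := integral_comp_eval (μ := fun _ : Fin n => gaussianReal 0 1) (i := j) (f := fun t => t)
    (by fun_prop)
  rw [integral_id_gaussianReal] at this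
  exact this

lemma integral_noise_eval_sq (j : Fin n) : ∫ z, z j ^ 2 ∂noise n = 1 := by
  have := integral_comp_eval (μ := fun _ : Fin n => gaussianReal 0 1) (i := j)
    (f := fun t => t ^ 2) (by fun_prop)
  have hv := variance_fun_id_gaussianReal (μ := 0) (v := 1)
  rw [variance_of_integral_eq_zero (by fun_prop) integral_id_gaussianReal] at hv
  rw [hv] at this
  exact this.trans NNReal.coe_one

lemma integral_noise_add_sq (a s : ℝ) (j : Fin n) :
    ∫ z, (a + s * z j) ^ 2 ∂noise n = a ^ 2 + s ^ 2 := by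
  have h1 : Integrable (fun z : Fin n → ℝ => z j) (noise n) :=
    (memLp_noise_eval j).integrable (by norm_num)
  have h2 : Integrable (fun z : Fin n → ℝ => z j ^ 2) (noise n) := (memLp_noise_eval j).integrable_sq
  have : ∀ z : Fin n → ℝ, (a + s * z j) ^ 2 = (a ^ 2 + 2 * a * s * z j) + s ^ 2 * z j ^ 2 :=
    fun z => by ring
  have h3 : Integrable (fun z : Fin n → ℝ => a ^ 2 + 2 * a * s * z j) (noise n) :=
    (integrable_const _).add (h1.const_mul _)
  simp_rw [this]
  rw [integral_add h3 (h2.const_mul _),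
    integral_add (integrable_const _) (h1.const_mul _), integral_const_mul, integral_const_mul,
    integral_noise_eval, integral_noise_eval_sq]
  simp

lemma integrable_log_gaussDensity {Ω : Type*} [MeasurableSpace Ω] {ν : Measure Ω}
    [IsProbabilityMeasure ν] (x : Fin n → ℝ) {s : ℝ} (hs : 0 < s) {T : Ω → Fin n → ℝ}
    (hL : ∀ j, MemLp (fun ω => T ω j) 2 ν) :
    Integrable (fun ω => Real.log (gaussDensity x s (T ω))) ν := by
  simp_rw [log_gaussDensity _ _ hs]
  refine (integrable_const _).sub (Integrable.div_const (integrable_finsetSum _ fun j _ => ?_) _)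
  exact ((hL j).sub (memLp_const (x j))).integrable_sq

section
variable [Nonempty ι]

lemma mixDensity_pos (x : ι → Fin n → ℝ) {s : ℝ} (hs : 0 < s) (y : Fin n → ℝ) :
    0 < mixDensity x s y :=
  div_pos (Finset.sum_pos (fun i _ => gaussDensity_pos _ _ hs) Finset.univ_nonempty)
    (by exact_mod_cast Fintype.card_pos)

lemma card_mul_mixDensity (x : ι → Fin n → ℝ) (s : ℝ) (y : Fin n → ℝ) :
    Fintype.card ι * mixDensity x s y = ∑ i, gaussDensity (x i) s y :=
  mul_div_cancel₀ _ (by exact_mod_cast Fintype.card_ne_zero)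

/-- The law of `X + s Z`. -/
lemma sum_lintegral_noise (x : ι → Fin n → ℝ) {s : ℝ} (hs : 0 < s) {f : (Fin n → ℝ) → ℝ≥0∞}
    (hf : Measurable f) :
    ∑ i, ∫⁻ z, f (x i + s • z) ∂noise n
      = Fintype.card ι * ∫⁻ y, f y * ENNReal.ofReal (mixDensity x s y) := by
  simp_rw [lintegral_noise _ hs hf]
  have h (i : ι) : Measurable fun y => f y * ENNReal.ofReal (gaussDensity (x i) s y) :=
    hf.mul (measurable_gaussDensity _ _).ennreal_ofReal
  have hm : Measurable fun y => f y * ENNReal.ofReal (mixDensity x s y) :=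
    hf.mul (measurable_mixDensity _ _).ennreal_ofReal
  rw [← lintegral_finsetSum _ fun i _ => h i, ← lintegral_const_mul _ hm]
  refine lintegral_congr fun y => ?_
  rw [← Finset.mul_sum, ← ENNReal.ofReal_sum_of_nonneg fun i _ => (gaussDensity_pos _ _ hs).le,
    ← card_mul_mixDensity, ENNReal.ofReal_mul (by positivity), ENNReal.ofReal_natCast]
  ring

lemma lintegral_mixDensity (x : ι → Fin n → ℝ) {s : ℝ} (hs : 0 < s) :
    ∫⁻ y, ENNReal.ofReal (mixDensity x s y) = 1 := by
  have h := sum_lintegral_noise x hs (f := fun _ => 1) measurable_const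
  simp only [lintegral_const, measure_univ, mul_one, Finset.sum_const, Finset.card_univ,
    nsmul_eq_mul, one_mul] at h
  have h0 : (Fintype.card ι : ℝ≥0∞) ≠ 0 := by exact_mod_cast Fintype.card_ne_zero
  exact ((ENNReal.mul_eq_left h0 (ENNReal.natCast_ne_top _)).1 h.symm)

/-- A mixture never exceeds the peak of a Gaussian component, and is at least the component `i`
divided by the number of components. The logarithm thus grows at most quadratically, so second
moments suffice for its integrability. -/
lemma abs_log_mixDensity_le (x : ι → Fin n → ℝ) {s : ℝ} (hs : 0 < s) (i : ι) (y : Fin n → ℝ) :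
    |Real.log (mixDensity x s y)| ≤ |(n : ℝ) * (Real.log s + Real.log (2 * Real.pi) / 2)|
      + Real.log (Fintype.card ι) + (∑ j, (y j - x i j) ^ 2) / (2 * s ^ 2) := by
  set c := (n : ℝ) * (Real.log s + Real.log (2 * Real.pi) / 2) with hc
  have hK : (0 : ℝ) < Fintype.card ι := by exact_mod_cast Fintype.card_pos
  have hlogK : 0 ≤ Real.log (Fintype.card ι) := Real.log_natCast_nonneg _
  have hS : 0 ≤ (∑ j, (y j - x i j) ^ 2) / (2 * s ^ 2) :=
    div_nonneg (Finset.sum_nonneg fun j _ => sq_nonneg _) (by positivity)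
  have hup : Real.log (mixDensity x s y) ≤ -c := by
    rw [Real.log_le_iff_le_exp (mixDensity_pos x hs y), mixDensity, div_le_iff₀ hK]
    have : ∀ k ∈ Finset.univ, gaussDensity (x k) s y ≤ Real.exp (-c) := fun k _ => by
      rw [← Real.log_le_iff_le_exp (gaussDensity_pos _ _ hs), log_gaussDensity _ _ hs, ← hc]
      have : 0 ≤ (∑ j, (y j - x k j) ^ 2) / (2 * s ^ 2) :=
        div_nonneg (Finset.sum_nonneg fun j _ => sq_nonneg _) (by positivity)
      linarith
    refine (Finset.sum_le_card_nsmul _ _ _ this).trans_eq ?_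
    rw [nsmul_eq_mul, Finset.card_univ, mul_comm]
  have hlo : -c - (∑ j, (y j - x i j) ^ 2) / (2 * s ^ 2) - Real.log (Fintype.card ι)
      ≤ Real.log (mixDensity x s y) := by
    rw [hc, ← log_gaussDensity _ _ hs, ← Real.log_div (gaussDensity_pos _ _ hs).ne' hK.ne']
    refine Real.log_le_log (div_pos (gaussDensity_pos _ _ hs) hK) ?_
    unfold mixDensity
    gcongr
    exact Finset.single_le_sum (f := fun k => gaussDensity (x k) s y)
      (fun k _ => (gaussDensity_pos _ _ hs).le) (Finset.mem_univ i)
  rw [abs_le]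
  constructor <;> linarith [neg_abs_le c, le_abs_self c, neg_le_abs c]

lemma integrable_log_mixDensity {Ω : Type*} [MeasurableSpace Ω] {ν : Measure Ω}
    [IsProbabilityMeasure ν] (x : ι → Fin n → ℝ) {s : ℝ} (hs : 0 < s) {T : Ω → Fin n → ℝ}
    (hT : Measurable T) (hL : ∀ j, MemLp (fun ω => T ω j) 2 ν) :
    Integrable (fun ω => Real.log (mixDensity x s (T ω))) ν := by
  obtain ⟨i⟩ := ‹Nonempty ι›
  refine Integrable.mono' (g := fun ω =>
    |(n : ℝ) * (Real.log s + Real.log (2 * Real.pi) / 2)| + Real.log (Fintype.card ι)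
      + (∑ j, (T ω j - x i j) ^ 2) / (2 * s ^ 2)) ?_
    (((measurable_mixDensity x s).comp hT).log.aestronglyMeasurable)
    (Eventually.of_forall fun ω => ?_)
  · refine (integrable_const _).add (Integrable.div_const (integrable_finsetSum _ fun j _ => ?_) _)
    exact ((hL j).sub (memLp_const (x i j))).integrable_sq
  · have : Nonempty ι := ⟨i⟩
    exact abs_log_mixDensity_le x hs i _

lemma memLp_add_noise (x : Fin n → ℝ) (s : ℝ) (j : Fin n) :
    MemLp (fun z : Fin n → ℝ => (x + s • z) j) 2 (noise n) :=
  (memLp_const (x j)).add ((memLp_noise_eval j).const_mul s)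

lemma memLp_add_noise_prod (x : Fin n → ℝ) (c d : ℝ) (j : Fin n) :
    MemLp (fun z : (Fin n → ℝ) × (Fin n → ℝ) => (x + (c • z.1 + d • z.2)) j) 2
      ((noise n).prod (noise n)) :=
  (memLp_const (x j)).add ((((memLp_noise_eval j).comp_measurePreserving
    measurePreserving_fst).const_mul c).add (((memLp_noise_eval j).comp_measurePreserving
    measurePreserving_snd).const_mul d))

/-- Scaling rule for differential entropy. It turns the entropy of one user's signal as interference
at the other receiver into that of the signal itself, which makes the cancellations between users
possible. -/
lemma ent_smul (x : ι → Fin n → ℝ) {g s : ℝ} (hg : g ≠ 0) (hs : 0 < s) :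
    ent (fun i => g • x i) (|g| * s) = ent x s + n * Real.log |g| := by
  have hg' := abs_pos.2 hg
  have hK : (Fintype.card ι : ℝ) ≠ 0 := by exact_mod_cast Fintype.card_ne_zero
  -- For negative `g` the noise is scaled by `|g|` but the codebook by `g`; the symmetry of the
  -- noise reconciles the two.
  have hflip : ∀ (f : (Fin n → ℝ) → ℝ), Measurable f →
      ∫ z, f (|g| • z) ∂noise n = ∫ z, f (g • z) ∂noise n := by
    intro f hf
    have h : (noise n).map (fun z => |g| • z) = (noise n).map (fun z => g • z) := by
      rcases abs_choice g with h | h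
      · rw [h]
      · have hneg : MeasurePreserving (fun z : Fin n → ℝ => -z) (noise n) (noise n) :=
          measurePreserving_pi _ _ fun _ => ⟨measurable_neg, by
            change (gaussianReal 0 1).map (fun t => -t) = _
            rw [gaussianReal_map_neg, neg_zero]⟩
        conv_lhs => rw [h]
        conv_rhs => rw [← hneg.map_eq]
        rw [Measure.map_map (by fun_prop) (by fun_prop)]
        congr 1
        ext z j
        simp
    rw [← integral_map (φ := fun z : Fin n → ℝ => |g| • z) (by fun_prop)
      hf.aestronglyMeasurable, h, integral_map (by fun_prop) hf.aestronglyMeasurable]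
  have hterm : ∀ i, ∫ z, Real.log (mixDensity (fun i => g • x i) (|g| * s)
        (g • x i + (|g| * s) • z)) ∂noise n
      = ∫ z, Real.log (mixDensity x s (x i + s • z)) ∂noise n - n * Real.log |g| := fun i => by
    have hm := measurable_mixDensity (fun i => g • x i) (|g| * s)
    have h := hflip (fun z => Real.log (mixDensity (fun i => g • x i) (|g| * s)
        (g • x i + s • z))) ((hm.comp (by fun_prop)).log)
    simp only [smul_smul, mul_comm s] at h
    rw [h]
    have : ∀ z : Fin n → ℝ, Real.log (mixDensity (fun i => g • x i) (|g| * s)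
        (g • x i + (g * s) • z))
        = Real.log (mixDensity x s (x i + s • z)) - n * Real.log |g| := fun z => by
      rw [mul_smul, ← smul_add, mixDensity_smul _ _ hg hs, Real.log_mul (by positivity)
        (mixDensity_pos _ hs _).ne', Real.log_inv, Real.log_pow]
      ring
    simp_rw [this]
    rw [integral_sub (integrable_log_mixDensity _ hs (by fun_prop) (memLp_add_noise _ _))
      (integrable_const _)]
    simp
  unfold ent
  simp_rw [hterm]
  rw [Finset.sum_sub_distrib]
  simp only [Finset.sum_const, Finset.card_univ, nsmul_eq_mul]
  field_simp
  ring
end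

lemma integral_log_gaussDensity_self (x : Fin n → ℝ) {s : ℝ} (hs : 0 < s) :
    ∫ z, Real.log (gaussDensity x s (x + s • z)) ∂noise n
      = -(n * (Real.log s + Real.log (2 * Real.pi) / 2 + 1 / 2)) := by
  simp_rw [log_gaussDensity _ _ hs]
  have h : ∀ (z : Fin n → ℝ) j, ((x + s • z) j - x j) ^ 2 = (0 + s * z j) ^ 2 := fun z j => by
    simp
  simp_rw [h]
  have hi : ∀ j : Fin n, Integrable (fun z : Fin n → ℝ => (0 + s * z j) ^ 2) (noise n) :=
    fun j => ((memLp_const (0 : ℝ)).add ((memLp_noise_eval j).const_mul s)).integrable_sq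
  rw [integral_sub (integrable_const _) ((integrable_finsetSum _ fun j _ => hi j).div_const _),
    integral_div, integral_finsetSum _ fun j _ => hi j]
  simp_rw [integral_noise_add_sq]
  simp
  field_simp
  ring

end

/-! ### Three rate bounds for a single receiver -/

section

variable {n : ℕ} {ι κ : Type*} [Fintype ι] [Fintype κ]

/-- The average error probability of the decoder `dec` of the first of two users with codebooks
`x` and `w`, in unit-variance Gaussian noise. -/
def errorProb [DecidableEq ι] (x : ι → Fin n → ℝ) (w : κ → Fin n → ℝ) (dec : (Fin n → ℝ) → ι) : ℝ :=
  (∑ m, ∑ k, (noise n).real {z | dec (x m + w k + z) ≠ m}) / (Fintype.card ι * Fintype.card κ)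

/-- The lower bound on the information rate of a code implied by its error probability. -/
def fanoRate [DecidableEq ι] (x : ι → Fin n → ℝ) (w : κ → Fin n → ℝ) (dec : (Fin n → ℝ) → ι) : ℝ :=
  (1 - errorProb x w dec) * Real.log (Fintype.card ι) - Real.log 2

/-- The differential entropy of `s Z` for `Z` standard Gaussian in dimension `n`. -/
def gaussEnt (n : ℕ) (s : ℝ) : ℝ := n * (Real.log s + Real.log (2 * Real.pi) / 2 + 1 / 2)

lemma mixDensity_add (u : Fin n → ℝ) (w : κ → Fin n → ℝ) (s : ℝ) (y : Fin n → ℝ) :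
    mixDensity (fun k => u + w k) s y = mixDensity w s (y - u) := by
  unfold mixDensity
  simp_rw [gaussDensity_add]

lemma sum_integral_log_mixDensity [Nonempty ι] (x : ι → Fin n → ℝ) (s : ℝ) :
    ∑ i, ∫ z, Real.log (mixDensity x s (x i + s • z)) ∂noise n = -(Fintype.card ι * ent x s) := by
  have hK : (Fintype.card ι : ℝ) ≠ 0 := by exact_mod_cast Fintype.card_ne_zero
  unfold ent
  field_simp

/-- The variance of a sum of independent variables is the sum of the variances, each at most the
second moment. -/
lemma sum_sum_sq_sub_mean_le [Nonempty ι] [Nonempty κ] (a : ι → ℝ) (b : κ → ℝ) :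
    ∑ m, ∑ k, (a m + b k - ((∑ i, a i) / Fintype.card ι + (∑ i, b i) / Fintype.card κ)) ^ 2
      ≤ Fintype.card κ * ∑ m, a m ^ 2 + Fintype.card ι * ∑ k, b k ^ 2 := by
  have hM : (0 : ℝ) < Fintype.card ι := by exact_mod_cast Fintype.card_pos
  have hK : (0 : ℝ) < Fintype.card κ := by exact_mod_cast Fintype.card_pos
  set A := (∑ i, a i) / Fintype.card ι with hA
  set B := (∑ i, b i) / Fintype.card κ with hB
  have hA' : ∑ i, a i = Fintype.card ι * A := by rw [hA]; field_simp
  have hB' : ∑ i, b i = Fintype.card κ * B := by rw [hB]; field_simp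
  have h : ∀ m k, (a m + b k - (A + B)) ^ 2
      = a m ^ 2 + b k ^ 2 + 2 * (a m * b k) - 2 * (A + B) * a m - 2 * (A + B) * b k
        + (A + B) ^ 2 := fun m k => by ring
  simp_rw [h, Finset.sum_add_distrib, Finset.sum_sub_distrib, Finset.sum_add_distrib,
    ← Finset.mul_sum, ← Finset.sum_mul]
  simp only [Finset.sum_const, Finset.card_univ, nsmul_eq_mul, ← Finset.mul_sum, hA', hB']
  nlinarith [mul_nonneg (mul_pos hM hK).le (sq_nonneg A), mul_nonneg (mul_pos hM hK).le (sq_nonneg B)]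

variable [Nonempty ι] [Nonempty κ] [DecidableEq ι]

/-- The rate bound without side information, with the output entropy bounded through its
variance. -/
lemma fanoRate_le_of_power (x : ι → Fin n → ℝ) (w : κ → Fin n → ℝ) (dec : (Fin n → ℝ) → ι)
    (hdec : ∀ m, MeasurableSet (dec ⁻¹' {m})) {a b τ : ℝ} (hτ : 0 < τ)
    (hx : ∀ m, ∑ j, x m j ^ 2 ≤ a) (hw : ∀ k, ∑ j, w k j ^ 2 ≤ b) (hab : a + b + n ≤ n * τ ^ 2) :
    fanoRate x w dec ≤ gaussEnt n τ - ent w 1 := by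
  have hM : (0 : ℝ) < Fintype.card ι := by exact_mod_cast Fintype.card_pos
  have hK : (0 : ℝ) < Fintype.card κ := by exact_mod_cast Fintype.card_pos
  -- The reference Gaussian is centred at the mean output. Centred at 0, it would leave a cross term
  -- between the means of the two codebooks, which can be positive.
  set u : Fin n → ℝ := fun j =>
    (∑ i, x i j) / Fintype.card ι + (∑ i, w i j) / Fintype.card κ with hu
  have hmem : ∀ m k j, MemLp (fun z : Fin n → ℝ => (x m + w k + z) j) 2 (noise n) :=
    fun m k j => by simpa using memLp_add_noise (x m + w k) 1 j
  have hsub : ∀ m k (z : Fin n → ℝ), x m + w k + z - x m = w k + (1 : ℝ) • z := fun m k z => by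
    rw [one_smul]; abel
  have hp : ∀ m k, Integrable (fun z => Real.log (mixDensity w 1 (x m + w k + z - x m)))
      (noise n) := fun m k => by
    simp_rw [hsub]
    exact integrable_log_mixDensity w one_pos (by fun_prop) (memLp_add_noise _ _)
  have hq : ∀ m k, Integrable (fun z => Real.log (gaussDensity u τ (x m + w k + z)))
      (noise n) := fun m k => integrable_log_gaussDensity u hτ (hmem m k)
  have key := converse_bound (volume : Measure (Fin n → ℝ)) (noise n)
    (fun m k z => x m + w k + z) (fun m k => by fun_prop) dec hdec
    (fun m y => mixDensity w 1 (y - x m)) (gaussDensity u τ)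
    (fun m y => mixDensity_pos w one_pos _) (fun y => gaussDensity_pos _ _ hτ)
    (fun m => (measurable_mixDensity w 1).comp (by fun_prop)) (measurable_gaussDensity _ _)
    (fun m f hf => by
      have := sum_lintegral_noise (fun k => x m + w k) one_pos hf
      simp_rw [mixDensity_add, one_smul] at this
      exact this)
    (lintegral_gaussDensity u hτ).le hp hq
  refine key.trans ?_
  rw [div_le_iff₀ (by positivity)]
  simp_rw [Finset.sum_sub_distrib, hsub, sum_integral_log_mixDensity]
  have hqv : ∀ m k, ∫ z, Real.log (gaussDensity u τ (x m + w k + z)) ∂noise n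
      = -(n * (Real.log τ + Real.log (2 * Real.pi) / 2))
        - (∑ j, ((x m j + w k j - u j) ^ 2 + 1)) / (2 * τ ^ 2) := fun m k => by
    simp_rw [log_gaussDensity _ _ hτ]
    have hi : ∀ j, Integrable (fun z : Fin n → ℝ => ((x m + w k + z) j - u j) ^ 2) (noise n) :=
      fun j => ((hmem m k j).sub (memLp_const (u j))).integrable_sq
    rw [integral_sub (integrable_const _) ((integrable_finsetSum _ fun j _ => hi j).div_const _),
      integral_div, integral_finsetSum _ fun j _ => hi j]
    have : ∀ j, ∫ z, ((x m + w k + z) j - u j) ^ 2 ∂noise n = (x m j + w k j - u j) ^ 2 + 1 :=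
      fun j => by
        have := integral_noise_add_sq (x m j + w k j - u j) 1 j
        rw [one_pow] at this
        rw [← this]
        congr 1
        ext z
        simp only [Pi.add_apply]
        ring
    simp_rw [this]
    simp
  have hpow : ∑ m, ∑ k, ∑ j, ((x m j + w k j - u j) ^ 2 + 1)
      ≤ Fintype.card ι * Fintype.card κ * (n * τ ^ 2) := by
    have h1 : ∑ m, ∑ k, ∑ j, ((x m j + w k j - u j) ^ 2 + 1)
        = ∑ j, (∑ m, ∑ k, (x m j + w k j - u j) ^ 2)
          + Fintype.card ι * Fintype.card κ * n := by
      simp_rw [Finset.sum_add_distrib]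
      congr 1
      · rw [Finset.sum_comm]
        simp_rw [Finset.sum_comm (s := (Finset.univ : Finset ι))]
        rw [Finset.sum_comm]
      · simp [mul_assoc]
    have h2 : ∑ j, (∑ m, ∑ k, (x m j + w k j - u j) ^ 2)
        ≤ ∑ j, (Fintype.card κ * ∑ m, x m j ^ 2 + Fintype.card ι * ∑ k, w k j ^ 2) :=
      Finset.sum_le_sum fun j _ => sum_sum_sq_sub_mean_le (fun m => x m j) (fun k => w k j)
    have hcx : ∑ j, ∑ m, x m j ^ 2 = ∑ m, ∑ j, x m j ^ 2 := Finset.sum_comm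
    have hcw : ∑ j, ∑ k, w k j ^ 2 = ∑ k, ∑ j, w k j ^ 2 := Finset.sum_comm
    rw [Finset.sum_add_distrib, ← Finset.mul_sum, ← Finset.mul_sum, hcx, hcw] at h2
    have h3 : ∑ m, ∑ j, x m j ^ 2 ≤ Fintype.card ι * a := by
      refine (Finset.sum_le_card_nsmul _ _ a fun m _ => hx m).trans_eq ?_
      rw [nsmul_eq_mul, Finset.card_univ]
    have h4 : ∑ k, ∑ j, w k j ^ 2 ≤ Fintype.card κ * b := by
      refine (Finset.sum_le_card_nsmul _ _ b fun m _ => hw m).trans_eq ?_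
      rw [nsmul_eq_mul, Finset.card_univ]
    have h5 := mul_le_mul_of_nonneg_left h3 hK.le
    have h6 := mul_le_mul_of_nonneg_left h4 hM.le
    have h7 := mul_le_mul_of_nonneg_left hab (mul_pos hM hK).le
    rw [h1]
    linarith
  have hpow' := div_le_div_of_nonneg_right hpow (by positivity : 0 ≤ 2 * τ ^ 2)
  have he : (Fintype.card ι : ℝ) * Fintype.card κ * (n * τ ^ 2) / (2 * τ ^ 2)
      = Fintype.card ι * Fintype.card κ * (n / 2) := by
    field_simp
  rw [he] at hpow'
  simp_rw [hqv, Finset.sum_sub_distrib, ← Finset.sum_div]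
  simp only [Finset.sum_const, Finset.card_univ, nsmul_eq_mul]
  unfold gaussEnt
  linarith

/-- The rate bound for a receiver that is told the interference and suffers from less noise. -/
lemma fanoRate_le_of_interference (x : ι → Fin n → ℝ) (w : κ → Fin n → ℝ)
    (dec : (Fin n → ℝ) → ι) (hdec : ∀ m, MeasurableSet (dec ⁻¹' {m})) {c : ℝ} (hc : 0 < c)
    (hc1 : c ≤ 1) :
    fanoRate x w dec ≤ ent x c - gaussEnt n c := by
  have hM : (0 : ℝ) < Fintype.card ι := by exact_mod_cast Fintype.card_pos
  have hK : (0 : ℝ) < Fintype.card κ := by exact_mod_cast Fintype.card_pos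
  set d := √(1 - c ^ 2) with hd
  have hcd : c ^ 2 + d ^ 2 = 1 := by
    rw [hd, Real.sq_sqrt (by nlinarith)]; ring
  have hrot := measurePreserving_noise (n := n) hcd
  have hval : ∀ f : (Fin n → ℝ) → ℝ, ∫ z, f z.1 ∂(noise n).prod (noise n) = ∫ z, f z ∂noise n :=
    fun f => by rw [integral_fun_fst]; simp
  -- Knowing the interference means working with a fixed `k`; the bound does not depend on it and is
  -- averaged at the end.
  have hbound : ∀ k, (1 - (∑ m, (noise n).real {z | dec (x m + w k + z) ≠ m})
      / Fintype.card ι) * Real.log (Fintype.card ι) - Real.log 2 ≤ ent x c - gaussEnt n c := by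
    intro k
    have hT : Measurable fun y : (Fin n → ℝ) × (Fin n → ℝ) => y.1 + w k + d • y.2 := by fun_prop
    have hmem : ∀ m j, MemLp (fun z : (Fin n → ℝ) × (Fin n → ℝ) => (x m + c • z.1) j) 2
        ((noise n).prod (noise n)) := fun m j =>
      (memLp_add_noise (x m) c j).comp_measurePreserving measurePreserving_fst
    -- The noise is split as cZ' + dZ'' and Z'' is handed to the receiver. As its law is part of the
    -- reference measure, the densities involve only the first coordinate.
    have key := converse_bound (κ := Unit) ((volume : Measure (Fin n → ℝ)).prod (noise n))
      ((noise n).prod (noise n)) (fun m _ z => (x m + c • z.1, z.2)) (fun m k => by fun_prop)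
      (fun y => dec (y.1 + w k + d • y.2)) (fun m => hT (hdec m))
      (fun m y => gaussDensity (x m) c y.1) (fun y => mixDensity x c y.1)
      (fun m y => gaussDensity_pos _ _ hc) (fun y => mixDensity_pos x hc _)
      (fun m => (measurable_gaussDensity _ _).comp measurable_fst)
      ((measurable_mixDensity _ _).comp measurable_fst)
      (fun m f hf => by
        have hm : Measurable fun z : (Fin n → ℝ) × (Fin n → ℝ) => f (x m + c • z.1, z.2) :=
          hf.comp (by fun_prop)
        have hm' : Measurable fun y : (Fin n → ℝ) × (Fin n → ℝ) =>
            f y * ENNReal.ofReal (gaussDensity (x m) c y.1) :=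
          hf.mul ((measurable_gaussDensity _ _).comp measurable_fst).ennreal_ofReal
        simp only [Finset.univ_unique, Finset.sum_singleton, Fintype.card_unit, Nat.cast_one,
          one_mul]
        rw [lintegral_prod_symm _ hm.aemeasurable, lintegral_prod_symm _ hm'.aemeasurable]
        refine lintegral_congr fun z => ?_
        exact lintegral_noise (x m) hc (f := fun y => f (y, z)) (hf.comp (by fun_prop)))
      (by
        have hm : Measurable fun y : (Fin n → ℝ) × (Fin n → ℝ) =>
            ENNReal.ofReal (mixDensity x c y.1) :=
          ((measurable_mixDensity _ _).comp measurable_fst).ennreal_ofReal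
        rw [lintegral_prod_symm _ hm.aemeasurable]
        simp [lintegral_mixDensity x hc])
      (fun m _ => integrable_log_gaussDensity _ hc (hmem m))
      (fun m _ => integrable_log_mixDensity _ hc (by fun_prop) (hmem m))
    have herr : ∀ m, ((noise n).prod (noise n)).real
        {z | dec (x m + c • z.1 + w k + d • z.2) ≠ m}
        = (noise n).real {z | dec (x m + w k + z) ≠ m} := fun m => by
      have hs : MeasurableSet {z | dec (x m + w k + z) ≠ m} :=
        ((by fun_prop : Measurable fun z => x m + w k + z) (hdec m)).compl
      rw [← hrot.measureReal_preimage hs.nullMeasurableSet]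
      congr 1
      ext z
      simp only [Set.mem_ofPred_eq, Set.mem_preimage]
      rw [show x m + c • z.1 + w k + d • z.2 = x m + w k + (c • z.1 + d • z.2) by abel]
    simp only [Finset.univ_unique, Finset.sum_singleton, Fintype.card_unit, Nat.cast_one,
      mul_one, herr] at key
    refine key.trans ?_
    rw [div_le_iff₀ hM, Finset.sum_sub_distrib]
    simp_rw [fun m => hval fun z => Real.log (gaussDensity (x m) c (x m + c • z)),
      fun m => hval fun z => Real.log (mixDensity x c (x m + c • z)),
      sum_integral_log_mixDensity, integral_log_gaussDensity_self _ hc]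
    simp only [Finset.sum_const, Finset.card_univ, nsmul_eq_mul]
    unfold gaussEnt
    linarith
  have hs := Finset.sum_le_sum fun k (_ : k ∈ Finset.univ) => hbound k
  simp only [Finset.sum_sub_distrib, ← Finset.sum_mul, ← Finset.sum_div, Finset.sum_const,
    Finset.card_univ, nsmul_eq_mul, mul_one] at hs
  unfold fanoRate errorProb
  rw [Finset.sum_comm]
  refine le_of_mul_le_mul_left ?_ hK
  refine le_trans (le_of_eq ?_) (hs.trans_eq (by ring))
  field_simp

/-- The rate bound for a receiver provided with a noisy observation of the interference, whose
noise is correlated with that of the channel. -/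
lemma fanoRate_le_of_noisy_interference (x : ι → Fin n → ℝ) (w : κ → Fin n → ℝ)
    (dec : (Fin n → ℝ) → ι) (hdec : ∀ m, MeasurableSet (dec ⁻¹' {m})) {s r : ℝ} (hs : 0 < s)
    (hr : 0 < r) (hsr : s ^ 2 / 4 + r ^ 2 = 1) :
    fanoRate x w dec ≤ ent x s + ent w 1 - gaussEnt n s - ent w r := by
  have hM : (0 : ℝ) < Fintype.card ι := by exact_mod_cast Fintype.card_pos
  have hK : (0 : ℝ) < Fintype.card κ := by exact_mod_cast Fintype.card_pos
  have hrot := measurePreserving_noise (n := n) (c := s / 2) (d := r) (by rw [← hsr]; ring)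
  have hrot' := measurePreserving_noise (n := n) (c := -(s / 2)) (d := r) (by rw [← hsr]; ring)
  have hval₁ : ∀ f : (Fin n → ℝ) → ℝ, ∫ z, f z.1 ∂(noise n).prod (noise n) = ∫ z, f z ∂noise n :=
    fun f => by rw [integral_fun_fst]; simp
  have hval₂ : ∀ f : (Fin n → ℝ) → ℝ, ∫ z, f z.2 ∂(noise n).prod (noise n) = ∫ z, f z ∂noise n :=
    fun f => by rw [integral_fun_snd]; simp
  have hval₃ : ∀ f : (Fin n → ℝ) → ℝ, Measurable f →
      ∫ z, f (-(s / 2) • z.1 + r • z.2) ∂(noise n).prod (noise n) = ∫ z, f z ∂noise n :=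
    fun f hf => by
      have h := integral_map (f := f) hrot'.aemeasurable hf.aestronglyMeasurable
      rw [hrot'.map_eq] at h
      exact h.symm
  have hmem₁ : ∀ m j, MemLp (fun z : (Fin n → ℝ) × (Fin n → ℝ) => (x m + s • z.1) j) 2
      ((noise n).prod (noise n)) := fun m j =>
    (memLp_add_noise (x m) s j).comp_measurePreserving measurePreserving_fst
  have hmem₂ : ∀ k j, MemLp (fun z : (Fin n → ℝ) × (Fin n → ℝ) => (w k + r • z.2) j) 2
      ((noise n).prod (noise n)) := fun k j =>
    (memLp_add_noise (w k) r j).comp_measurePreserving measurePreserving_snd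
  -- The coefficient −s/2 gives noise variance s²/4 + r² = 1 both to the second observation and to
  -- the sum of the two. Given the message, the first observation reveals Z', and adding half its
  -- noise to the second leaves W + rZ'', with W the interference.
  have hcoord : ∀ m k (z : (Fin n → ℝ) × (Fin n → ℝ)),
      w k + (-(s / 2) • z.1 + r • z.2) + (1 / 2 : ℝ) • (x m + s • z.1 - x m)
        = w k + r • z.2 := fun m k z => by
    ext j
    simp only [Pi.add_apply, Pi.sub_apply, Pi.smul_apply, smul_eq_mul]
    ring
  have hi₁ : ∀ m, Integrable (fun z : (Fin n → ℝ) × (Fin n → ℝ) =>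
      Real.log (gaussDensity (x m) s (x m + s • z.1))) ((noise n).prod (noise n)) := fun m =>
    integrable_log_gaussDensity _ hs (hmem₁ m)
  have hi₂ : ∀ k, Integrable (fun z : (Fin n → ℝ) × (Fin n → ℝ) =>
      Real.log (mixDensity w r (w k + r • z.2))) ((noise n).prod (noise n)) := fun k =>
    integrable_log_mixDensity _ hr (by fun_prop) (hmem₂ k)
  have hi₃ : ∀ m, Integrable (fun z : (Fin n → ℝ) × (Fin n → ℝ) =>
      Real.log (mixDensity x s (x m + s • z.1))) ((noise n).prod (noise n)) := fun m =>
    integrable_log_mixDensity _ hs (by fun_prop) (hmem₁ m)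
  have hi₄ : ∀ k, Integrable (fun z : (Fin n → ℝ) × (Fin n → ℝ) =>
      Real.log (mixDensity w 1 (w k + (-(s / 2) • z.1 + r • z.2))))
      ((noise n).prod (noise n)) := fun k =>
    integrable_log_mixDensity _ one_pos (by fun_prop) (memLp_add_noise_prod _ _ _)
  have hlogp : ∀ m k (z : (Fin n → ℝ) × (Fin n → ℝ)),
      Real.log (gaussDensity (x m) s (x m + s • z.1) * mixDensity w r
        (w k + (-(s / 2) • z.1 + r • z.2) + (1 / 2 : ℝ) • (x m + s • z.1 - x m)))
      = Real.log (gaussDensity (x m) s (x m + s • z.1))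
        + Real.log (mixDensity w r (w k + r • z.2)) := fun m k z => by
    rw [hcoord, Real.log_mul (gaussDensity_pos _ _ hs).ne' (mixDensity_pos _ hr _).ne']
  have hlogq : ∀ m k (z : (Fin n → ℝ) × (Fin n → ℝ)),
      Real.log (mixDensity x s (x m + s • z.1) *
        mixDensity w 1 (w k + (-(s / 2) • z.1 + r • z.2)))
      = Real.log (mixDensity x s (x m + s • z.1))
        + Real.log (mixDensity w 1 (w k + (-(s / 2) • z.1 + r • z.2))) := fun m k z => by
    rw [Real.log_mul (mixDensity_pos _ hs _).ne' (mixDensity_pos _ one_pos _).ne']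
  have hpm : ∀ m, Measurable fun y : (Fin n → ℝ) × (Fin n → ℝ) =>
      gaussDensity (x m) s y.1 * mixDensity w r (y.2 + (1 / 2 : ℝ) • (y.1 - x m)) := fun m =>
    ((measurable_gaussDensity _ _).comp measurable_fst).mul
      ((measurable_mixDensity _ _).comp (by fun_prop))
  have hqm : Measurable fun y : (Fin n → ℝ) × (Fin n → ℝ) =>
      mixDensity x s y.1 * mixDensity w 1 y.2 :=
    ((measurable_mixDensity _ _).comp measurable_fst).mul
      ((measurable_mixDensity _ _).comp measurable_snd)
  have hlaw : ∀ m, ∀ f : (Fin n → ℝ) × (Fin n → ℝ) → ℝ≥0∞, Measurable f →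
      ∑ k, ∫⁻ z, f (x m + s • z.1, w k + (-(s / 2) • z.1 + r • z.2)) ∂(noise n).prod (noise n)
      = Fintype.card κ * ∫⁻ y, f y * ENNReal.ofReal (gaussDensity (x m) s y.1 *
          mixDensity w r (y.2 + (1 / 2 : ℝ) • (y.1 - x m)))
          ∂(volume : Measure (Fin n → ℝ)).prod (volume : Measure (Fin n → ℝ)) := by
    intro m f hf
    have hfm : ∀ k, Measurable fun z : (Fin n → ℝ) × (Fin n → ℝ) =>
        f (x m + s • z.1, w k + (-(s / 2) • z.1 + r • z.2)) := fun k => hf.comp (by fun_prop)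
    have hgm : Measurable fun y : (Fin n → ℝ) × (Fin n → ℝ) =>
        f y * ENNReal.ofReal (mixDensity w r (y.2 + (1 / 2 : ℝ) • (y.1 - x m))) :=
      hf.mul ((measurable_mixDensity _ _).comp (by fun_prop)).ennreal_ofReal
    -- With the first noise fixed, the second observation is the interference codebook shifted by a
    -- constant, in noise of level `r`.
    have hinner : ∀ z₁ : Fin n → ℝ,
        ∑ k, ∫⁻ z₂, f (x m + s • z₁, w k + (-(s / 2) • z₁ + r • z₂)) ∂noise n
        = Fintype.card κ * ∫⁻ b, f (x m + s • z₁, b) * ENNReal.ofReal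
          (mixDensity w r (b + (1 / 2 : ℝ) • (x m + s • z₁ - x m))) := fun z₁ => by
      have h := sum_lintegral_noise (fun k => -(s / 2) • z₁ + w k) hr
        (f := fun b => f (x m + s • z₁, b)) (hf.comp (by fun_prop))
      simp_rw [mixDensity_add] at h
      convert h using 4 with k _ z b
      · abel_nf
      · congr 3
        ext j
        simp only [Pi.add_apply, Pi.sub_apply, Pi.smul_apply, smul_eq_mul]
        ring
    have hout : Measurable fun a => ∫⁻ b, f (a, b) * ENNReal.ofReal
        (mixDensity w r (b + (1 / 2 : ℝ) • (a - x m))) := hgm.lintegral_prod_right'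
    rw [Finset.sum_congr rfl fun k _ => lintegral_prod _ (hfm k).aemeasurable]
    rw [← lintegral_finsetSum _ fun k _ => (hfm k).lintegral_prod_right']
    simp_rw [hinner]
    have hmul := lintegral_const_mul (μ := noise n) (Fintype.card κ : ℝ≥0∞)
      (hout.comp (by fun_prop : Measurable fun z => x m + s • z))
    simp only [Function.comp_apply] at hmul
    have hfp : Measurable fun y : (Fin n → ℝ) × (Fin n → ℝ) => f y * ENNReal.ofReal
        (gaussDensity (x m) s y.1 * mixDensity w r (y.2 + (1 / 2 : ℝ) • (y.1 - x m))) :=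
      hf.mul (hpm m).ennreal_ofReal
    rw [hmul, lintegral_noise (x m) hs hout, lintegral_prod _ hfp.aemeasurable]
    congr 1
    refine lintegral_congr fun a => ?_
    have hmul' := lintegral_mul_const (μ := volume) (ENNReal.ofReal (gaussDensity (x m) s a))
      (hgm.comp (by fun_prop : Measurable fun b : Fin n → ℝ => (a, b)))
    simp only [Function.comp_apply] at hmul'
    rw [← hmul']
    refine lintegral_congr fun b => ?_
    rw [ENNReal.ofReal_mul (gaussDensity_pos _ _ hs).le]
    ring
  have hq1 : ∫⁻ y, ENNReal.ofReal (mixDensity x s y.1 * mixDensity w 1 y.2)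
      ∂(volume : Measure (Fin n → ℝ)).prod (volume : Measure (Fin n → ℝ)) ≤ 1 := by
    rw [lintegral_congr fun y : (Fin n → ℝ) × (Fin n → ℝ) =>
        ENNReal.ofReal_mul (q := mixDensity w 1 y.2) (mixDensity_pos x hs y.1).le,
      lintegral_prod_mul (measurable_mixDensity _ _).ennreal_ofReal.aemeasurable
      (measurable_mixDensity _ _).ennreal_ofReal.aemeasurable,
      lintegral_mixDensity x hs, lintegral_mixDensity w one_pos, one_mul]
  have hsum : Measurable fun y : (Fin n → ℝ) × (Fin n → ℝ) => y.1 + y.2 := by fun_prop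
  -- The auxiliary law is the product of the two marginals, which amounts to subadditivity of
  -- entropy; the decoder acts on the sum of the observations.
  have key := converse_bound
    ((volume : Measure (Fin n → ℝ)).prod (volume : Measure (Fin n → ℝ)))
    ((noise n).prod (noise n))
    (fun m k z => (x m + s • z.1, w k + (-(s / 2) • z.1 + r • z.2))) (fun m k => by fun_prop)
    (fun y => dec (y.1 + y.2)) (fun m => hsum (hdec m))
    (fun m y => gaussDensity (x m) s y.1 * mixDensity w r (y.2 + (1 / 2 : ℝ) • (y.1 - x m)))
    (fun y => mixDensity x s y.1 * mixDensity w 1 y.2)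
    (fun m y => mul_pos (gaussDensity_pos _ _ hs) (mixDensity_pos _ hr _))
    (fun y => mul_pos (mixDensity_pos _ hs _) (mixDensity_pos _ one_pos _))
    hpm hqm hlaw hq1
    (fun m k => by simp_rw [hlogp]; exact (hi₁ m).add (hi₂ k))
    (fun m k => by simp_rw [hlogq]; exact (hi₃ m).add (hi₄ k))
  have herr : ∀ m k, ((noise n).prod (noise n)).real
      {z | dec (x m + s • z.1 + (w k + (-(s / 2) • z.1 + r • z.2))) ≠ m}
      = (noise n).real {z | dec (x m + w k + z) ≠ m} := fun m k => by
    have hs : MeasurableSet {z | dec (x m + w k + z) ≠ m} :=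
      ((by fun_prop : Measurable fun z => x m + w k + z) (hdec m)).compl
    rw [← hrot.measureReal_preimage hs.nullMeasurableSet]
    congr 1
    ext z
    simp only [Set.mem_ofPred_eq, Set.mem_preimage]
    rw [show x m + s • z.1 + (w k + (-(s / 2) • z.1 + r • z.2))
      = x m + w k + ((s / 2) • z.1 + r • z.2) by
        ext j
        simp only [Pi.add_apply, Pi.smul_apply, smul_eq_mul]
        ring]
  simp_rw [hlogp, hlogq, herr] at key
  refine key.trans ?_
  rw [div_le_iff₀ (by positivity)]
  simp_rw [fun m k => integral_add (hi₁ m) (hi₂ k), fun m k => integral_add (hi₃ m) (hi₄ k),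
    fun m => hval₁ fun z => Real.log (gaussDensity (x m) s (x m + s • z)),
    fun m => hval₁ fun z => Real.log (mixDensity x s (x m + s • z)),
    fun k => hval₂ fun z => Real.log (mixDensity w r (w k + r • z)),
    fun k => hval₃ (fun z => Real.log (mixDensity w 1 (w k + z)))
      ((measurable_mixDensity w 1).comp (by fun_prop)).log,
    integral_log_gaussDensity_self _ hs]
  have h1 := sum_integral_log_mixDensity w 1
  simp only [one_smul] at h1
  simp only [Finset.sum_sub_distrib, Finset.sum_add_distrib, Finset.sum_const, Finset.card_univ,
    nsmul_eq_mul, ← Finset.mul_sum, sum_integral_log_mixDensity, h1]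
  unfold gaussEnt
  linarith

end

/-! ### Sum-rate bounds by cancellation of entropies -/

section

section
variable {n : ℕ} {ι κ : Type*} [Fintype ι] [Fintype κ] [Nonempty ι] [Nonempty κ]
  [DecidableEq ι] [DecidableEq κ]

/-- The sum-rate bound from noisy interference with equal noise levels. -/
lemma fanoRate_add_le_of_weak {g P : ℝ} (hg : g ≠ 0) (hP : 0 ≤ P)
    (x₁ : ι → Fin n → ℝ) (x₂ : κ → Fin n → ℝ) (dec₁ : (Fin n → ℝ) → ι) (dec₂ : (Fin n → ℝ) → κ)
    (hd₁ : ∀ m, MeasurableSet (dec₁ ⁻¹' {m})) (hd₂ : ∀ m, MeasurableSet (dec₂ ⁻¹' {m}))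
    (hx₁ : ∀ m, ∑ j, x₁ m j ^ 2 ≤ n * P) (hx₂ : ∀ m, ∑ j, x₂ m j ^ 2 ≤ n * P) :
    fanoRate x₁ (fun k => g • x₂ k) dec₁ + fanoRate x₂ (fun k => g • x₁ k) dec₂
      ≤ n / 2 * Real.log ((1 + P + g ^ 2 * P) * ((4 * g ^ 2 + 1) / (4 * g ^ 2))) := by
  have hg' := abs_pos.2 hg
  have hw : ∀ (y : Fin n → ℝ), ∑ j, y j ^ 2 ≤ n * P → ∑ j, (g • y) j ^ 2 ≤ g ^ 2 * (n * P) :=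
    fun y hy => by
      simp only [Pi.smul_apply, smul_eq_mul, mul_pow, ← Finset.mul_sum]
      gcongr
  have hpos : 0 < 1 + P + g ^ 2 * P := by positivity
  set τ := √(1 + P + g ^ 2 * P) with hτ
  have hτ2 : τ ^ 2 = 1 + P + g ^ 2 * P := Real.sq_sqrt hpos.le
  have hτ0 : 0 < τ := Real.sqrt_pos.2 hpos
  have hpow : (n : ℝ) * P + g ^ 2 * (n * P) + n ≤ n * τ ^ 2 := by rw [hτ2]; linarith
  -- The solution of s²/4 + r² = 1 with r = |g|s, so that h(gX₂ + rZ) is h(X₂ + sZ) up to the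
  -- scaling term.
  set s := √(4 / (4 * g ^ 2 + 1)) with hs
  have hs2 : s ^ 2 = 4 / (4 * g ^ 2 + 1) := Real.sq_sqrt (by positivity)
  have hs0 : 0 < s := Real.sqrt_pos.2 (by positivity)
  have hsr : s ^ 2 / 4 + (|g| * s) ^ 2 = 1 := by
    rw [mul_pow, sq_abs, hs2]; field_simp; ring
  have a₁ := fanoRate_le_of_power x₁ (fun k => g • x₂ k) dec₁ hd₁ hτ0 hx₁
    (fun k => hw _ (hx₂ k)) hpow
  have a₂ := fanoRate_le_of_power x₂ (fun k => g • x₁ k) dec₂ hd₂ hτ0 hx₂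
    (fun k => hw _ (hx₁ k)) hpow
  have b₁ := fanoRate_le_of_noisy_interference x₁ (fun k => g • x₂ k) dec₁ hd₁ hs0
    (mul_pos hg' hs0) hsr
  have b₂ := fanoRate_le_of_noisy_interference x₂ (fun k => g • x₁ k) dec₂ hd₂ hs0
    (mul_pos hg' hs0) hsr
  rw [ent_smul _ hg hs0] at b₁ b₂
  have hlog : Real.log ((1 + P + g ^ 2 * P) * ((4 * g ^ 2 + 1) / (4 * g ^ 2)))
      = 2 * Real.log τ - 2 * Real.log s - 2 * Real.log |g| := by
    have e : (1 + P + g ^ 2 * P) * ((4 * g ^ 2 + 1) / (4 * g ^ 2))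
        = τ ^ 2 / (s ^ 2 * |g| ^ 2) := by
      rw [hτ2, hs2, sq_abs]; field_simp
    rw [e, Real.log_div (by positivity) (by positivity), Real.log_mul (by positivity)
      (by positivity), Real.log_pow, Real.log_pow, Real.log_pow]
    push_cast
    ring
  rw [hlog]
  unfold gaussEnt at a₁ a₂ b₁ b₂
  -- The sum of the four bounds, halved: all codebook entropies cancel.
  linarith

/-- The sum-rate bound from time sharing between noisy and complete observations of the
interference. -/
lemma fanoRate_add_le_of_moderate {g P : ℝ} (hg : g ≠ 0) (hP : 0 ≤ P) (hg4 : 1 < 4 * g ^ 2)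
    (x₁ : ι → Fin n → ℝ) (x₂ : κ → Fin n → ℝ) (dec₁ : (Fin n → ℝ) → ι) (dec₂ : (Fin n → ℝ) → κ)
    (hd₁ : ∀ m, MeasurableSet (dec₁ ⁻¹' {m})) (hd₂ : ∀ m, MeasurableSet (dec₂ ⁻¹' {m}))
    (hx₁ : ∀ m, ∑ j, x₁ m j ^ 2 ≤ n * P) (hx₂ : ∀ m, ∑ j, x₂ m j ^ 2 ≤ n * P) :
    fanoRate x₁ (fun k => g • x₂ k) dec₁ + fanoRate x₂ (fun k => g • x₁ k) dec₂
      ≤ n / 2 * Real.log ((1 + P + g ^ 2 * P) * (2 * |g| / √(4 * g ^ 2 - 1))) := by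
  have hg' := abs_pos.2 hg
  have hg2 : 0 < g ^ 2 := by positivity
  have hw : ∀ (y : Fin n → ℝ), ∑ j, y j ^ 2 ≤ n * P → ∑ j, (g • y) j ^ 2 ≤ g ^ 2 * (n * P) :=
    fun y hy => by
      simp only [Pi.smul_apply, smul_eq_mul, mul_pow, ← Finset.mul_sum]
      gcongr
  have hpos : 0 < 1 + P + g ^ 2 * P := by positivity
  set τ := √(1 + P + g ^ 2 * P) with hτ
  have hτ2 : τ ^ 2 = 1 + P + g ^ 2 * P := Real.sq_sqrt hpos.le
  have hτ0 : 0 < τ := Real.sqrt_pos.2 hpos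
  have hpow : (n : ℝ) * P + g ^ 2 * (n * P) + n ≤ n * τ ^ 2 := by rw [hτ2]; linarith
  set q := √(4 * g ^ 2 - 1) with hq
  have hq2 : q ^ 2 = 4 * g ^ 2 - 1 := Real.sq_sqrt (by linarith)
  have hq0 : 0 < q := Real.sqrt_pos.2 (by linarith)
  -- the noise standard deviation left over for the enhanced receiver
  set c := q / (2 * g ^ 2) with hc
  have hc0 : 0 < c := by positivity
  have hc1 : c ≤ 1 := by
    rw [hc, div_le_one (by positivity)]
    exact Real.sqrt_le_iff.2 ⟨by positivity, by nlinarith [sq_nonneg (2 * g ^ 2 - 1)]⟩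
  -- With s = 1/|g|, X₁ + sZ is a rescaling of the interference gX₁ + Z. The constraint 1/(4g²) +
  -- g²c² = 1 then fixes `c`, and makes h(gX₂ + |g|cZ) cancel against the bound for the enhanced
  -- receiver.
  have hs0 : 0 < |g|⁻¹ := inv_pos.2 hg'
  have hone : |g| * |g|⁻¹ = 1 := mul_inv_cancel₀ hg'.ne'
  have hsr : |g|⁻¹ ^ 2 / 4 + (|g| * c) ^ 2 = 1 := by
    rw [mul_pow, inv_pow, sq_abs, hc, div_pow, hq2]; field_simp; ring
  have a₁ := fanoRate_le_of_power x₁ (fun k => g • x₂ k) dec₁ hd₁ hτ0 hx₁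
    (fun k => hw _ (hx₂ k)) hpow
  have a₂ := fanoRate_le_of_power x₂ (fun k => g • x₁ k) dec₂ hd₂ hτ0 hx₂
    (fun k => hw _ (hx₁ k)) hpow
  have b₁ := fanoRate_le_of_noisy_interference x₁ (fun k => g • x₂ k) dec₁ hd₁ hs0
    (mul_pos hg' hc0) hsr
  have b₂ := fanoRate_le_of_noisy_interference x₂ (fun k => g • x₁ k) dec₂ hd₂ hs0
    (mul_pos hg' hc0) hsr
  have c₁ := fanoRate_le_of_interference x₁ (fun k => g • x₂ k) dec₁ hd₁ hc0 hc1
  have c₂ := fanoRate_le_of_interference x₂ (fun k => g • x₁ k) dec₂ hd₂ hc0 hc1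
  have e₁ := ent_smul x₁ hg hs0
  have e₂ := ent_smul x₂ hg hs0
  rw [hone] at e₁ e₂
  rw [ent_smul _ hg hc0] at b₁ b₂
  have hlog : Real.log ((1 + P + g ^ 2 * P) * (2 * |g| / q))
      = 2 * Real.log τ - Real.log c - Real.log |g| := by
    have e : (1 + P + g ^ 2 * P) * (2 * |g| / q) = τ ^ 2 / (c * |g|) := by
      rw [hτ2, hc, ← sq_abs g]; field_simp
    rw [e, Real.log_div (by positivity) (by positivity), Real.log_mul (by positivity)
      (by positivity), Real.log_pow]
    push_cast
    ring
  rw [hlog]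
  unfold gaussEnt at a₁ a₂ b₁ b₂ c₁ c₂
  rw [Real.log_inv] at b₁ b₂
  -- The power bounds enter twice and the other four once, because the entropy of each interference
  -- plus noise occurs twice after rescaling; the total is four times the sum rate.
  linarith
end

/-! ### From codes to the capacity region -/

lemma Rbar_of_le {g P : ℝ} (hg : g ≠ 0) (hP : 0 ≤ P) (h : g ^ 2 ≤ 0.405) :
    Rbar g P * Real.log 2
      = 1 / 2 * Real.log ((1 + P + g ^ 2 * P) * ((4 * g ^ 2 + 1) / (4 * g ^ 2))) := by
  have hg' := abs_pos.2 hg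
  have hl : Real.log 2 ≠ 0 := (Real.log_pos one_lt_two).ne'
  have e : (1 + P + g ^ 2 * P) * ((4 * g ^ 2 + 1) / (4 * g ^ 2))
      = (|g| * P + |g|⁻¹ * (P + 1)) * ((4 * g ^ 2 + 1) / (4 * |g|)) := by
    rw [← sq_abs g]; field_simp; ring
  rw [Rbar, Rsym, gamma, if_pos h, e, Real.log_mul (by positivity) (by positivity), Real.logb,
    Real.logb]
  field_simp

lemma Rbar_of_lt {g P : ℝ} (hP : 0 ≤ P) (h : 0.405 < g ^ 2) :
    Rbar g P * Real.log 2
      = 1 / 2 * Real.log ((1 + P + g ^ 2 * P) * (2 * |g| / √(4 * g ^ 2 - 1))) := by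
  have hg : g ≠ 0 := by rintro rfl; norm_num at h
  have hg' := abs_pos.2 hg
  have hq0 : 0 < √(4 * g ^ 2 - 1) := Real.sqrt_pos.2 (by linarith)
  have hl : Real.log 2 ≠ 0 := (Real.log_pos one_lt_two).ne'
  have e : (1 + P + g ^ 2 * P) * (2 * |g| / √(4 * g ^ 2 - 1))
      = (|g| * P + |g|⁻¹ * (P + 1)) * (2 * g ^ 2 / √(4 * g ^ 2 - 1)) := by
    generalize √(4 * g ^ 2 - 1) = q at *
    rw [← sq_abs g]; field_simp; ring
  rw [Rbar, Rsym, gamma, if_neg h.not_ge, e, Real.log_mul (by positivity) (by positivity),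
    Real.logb, Real.logb]
  field_simp

lemma errorProb₁_eq (g : ℝ) {n M₁ M₂ : ℕ} {P : ℝ} (c : Code n M₁ M₂ P) :
    errorProb₁ g c = errorProb c.enc₁ (fun k => g • c.enc₂ k) c.dec₁ := by
  simp [errorProb₁, errorProb]

lemma errorProb₂_eq (g : ℝ) {n M₁ M₂ : ℕ} {P : ℝ} (c : Code n M₁ M₂ P) :
    errorProb₂ g c = errorProb c.enc₂ (fun k => g • c.enc₁ k) c.dec₂ := by
  rw [errorProb₂, errorProb, Finset.sum_comm, mul_comm (M₁ : ℝ)]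
  simp

lemma fanoRate_add_le {g P : ℝ} (hP : 0 ≤ P) (hg : g ≠ 0) {n M₁ M₂ : ℕ} [NeZero M₁] [NeZero M₂]
    (c : Code n M₁ M₂ P) :
    ((1 - errorProb₁ g c) * Real.log M₁ - Real.log 2)
      + ((1 - errorProb₂ g c) * Real.log M₂ - Real.log 2) ≤ n * (Rbar g P * Real.log 2) := by
  have h₁ : ∀ m, MeasurableSet (c.dec₁ ⁻¹' {m}) := fun m =>
    c.measurable_dec₁ (measurableSet_singleton m)
  have h₂ : ∀ m, MeasurableSet (c.dec₂ ⁻¹' {m}) := fun m =>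
    c.measurable_dec₂ (measurableSet_singleton m)
  rw [errorProb₁_eq, errorProb₂_eq]
  -- The two bounds coincide at g² = (1 + √5)/8 ≈ 0.4045, of which 0.405 is a rounding; the second
  -- needs only g² > 1/4.
  rcases le_or_gt (g ^ 2) 0.405 with h | h
  · have := fanoRate_add_le_of_weak hg hP c.enc₁ c.enc₂ c.dec₁ c.dec₂ h₁ h₂ c.power₁ c.power₂
    simp only [fanoRate, Fintype.card_fin] at this
    rw [Rbar_of_le hg hP h]
    linarith
  · have := fanoRate_add_le_of_moderate hg hP (by linarith) c.enc₁ c.enc₂ c.dec₁ c.dec₂ h₁ h₂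
      c.power₁ c.power₂
    simp only [fanoRate, Fintype.card_fin] at this
    rw [Rbar_of_lt hP h]
    linarith

lemma numMessages_pos (n : ℕ) (R : ℝ) : 0 < numMessages n R :=
  Nat.ceil_pos.2 (by positivity)

lemma le_log_numMessages (n : ℕ) (R : ℝ) : n * R * Real.log 2 ≤ Real.log (numMessages n R) := by
  rw [← Real.log_rpow two_pos]
  exact Real.log_le_log (by positivity) (Nat.le_ceil _)

theorem add_le_Rbar_of_achievable {g P : ℝ} (hP : 0 ≤ P) (hg : g ≠ 0) {R : ℝ × ℝ}
    (hR : Achievable g P R) : R.1 + R.2 ≤ Rbar g P := by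
  obtain ⟨-, -, c, h₁, h₂⟩ := hR
  have hl : 0 < Real.log 2 := Real.log_pos one_lt_two
  -- The term 2/n is the Fano loss of one bit per user, spread over the block.
  have hlim : Tendsto (fun n : ℕ => (1 - errorProb₁ g (c n)) * R.1 + (1 - errorProb₂ g (c n)) * R.2
      - 2 / n) atTop (𝓝 ((1 - 0) * R.1 + (1 - 0) * R.2 - 0)) :=
    (((h₁.const_sub 1).mul_const _).add ((h₂.const_sub 1).mul_const _)).sub
      (tendsto_const_div_atTop_nhds_zero_nat 2)
  simp only [sub_zero, one_mul] at hlim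
  refine le_of_tendsto hlim ?_
  -- Error probabilities at most 1 make the factors 1 − ε nonnegative, so the lower bounds on the
  -- log message counts may be multiplied by them.
  filter_upwards [h₁.eventually_le_const one_pos, h₂.eventually_le_const one_pos,
    eventually_gt_atTop 0] with n e₁ e₂ hn
  have : NeZero (numMessages n R.1) := ⟨(numMessages_pos n R.1).ne'⟩
  have : NeZero (numMessages n R.2) := ⟨(numMessages_pos n R.2).ne'⟩
  have key := fanoRate_add_le hP hg (c n)
  have k₁ := mul_le_mul_of_nonneg_left (le_log_numMessages n R.1) (sub_nonneg.2 e₁)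
  have k₂ := mul_le_mul_of_nonneg_left (le_log_numMessages n R.2) (sub_nonneg.2 e₂)
  have hn' : (0 : ℝ) < n := by exact_mod_cast hn
  refine le_of_mul_le_mul_left ?_ (mul_pos hn' hl)
  have : (n : ℝ) * Real.log 2 * ((1 - errorProb₁ g (c n)) * R.1 + (1 - errorProb₂ g (c n)) * R.2
      - 2 / n) = (1 - errorProb₁ g (c n)) * (n * R.1 * Real.log 2)
      + (1 - errorProb₂ g (c n)) * (n * R.2 * Real.log 2) - 2 * Real.log 2 := by
    field_simp
  rw [this]
  linarith

end

end GIC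

end

theorem mainTheorem7 (g P : ℝ) (hP : 0 ≤ P) (hg : 0 < g ^ 2) (hg1 : g ^ 2 ≤ 1)
    (R₁ R₂ : ℝ) (hR : (R₁, R₂) ∈ GIC.capacityRegion g P) :
    R₁ + R₂ ≤ GIC.Rbar g P := by
  have hg0 : g ≠ 0 := by rintro rfl; norm_num at hg
  have hclosed : IsClosed {R : ℝ × ℝ | R.1 + R.2 ≤ GIC.Rbar g P} :=
    isClosed_le (by fun_prop) continuous_const
  exact closure_minimal (fun R hR => GIC.add_le_Rbar_of_achievable hP hg0 hR) hclosed hR
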